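/- **Setting.** There are $n$ varieties $N=\{1,\dots,n\}$ with $\Omega_j$ units of variety $j$; packages are the subsets $S\in 2^N$. Buyers are $l\in[L]$, where $[m]:=\{1,\dots,m\}$; buyer $l$ consists of $\bar Q^l$ unit-demand agents with values $v^l(S,q)\in\mathbb Z_+$ ($v^l(S,q)=0$ for $q>\bar Q^l$), and $\bar Q=\max_l\bar Q^l$. A cost function graph is a directed graph on $2^N$ in which every arc $(T,S)$ satisfies $S\subsetneq T$ and every $S$ is connected by a directed path to $\{j\}$ for every $j\in S$. Let $R_0^+(S)$ be the set of packages reachable from $S$ by directed paths (including $S$), and $R^-(S)$ the set of packages $S'\ne S$ from which $S$ is reachable, $R_0^-(S)=R^-(S)\cup\{S\}$. Incremental costs are $\Delta c(S,r)\in\mathbb Z\cup\{\infty\}$ ($r\ge1$), nondecreasing in $r$, with $\Delta c(\{j\},r)=\infty$ for $r>\Omega_j$, finite only for finitely many steps $r$; $\bar R$ is the largest $r$ with $\Delta c(S,r)<\infty$ for some $S$ ($\bar R=0$ if there is none). The cost $\sum_S\sum_{r\le r_S}\Delta c(S,r)$, with $r_S=\sum_{S'\in R_0^-(S)}k_{S'}$,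 is nonnegative for every $k\in\mathbb Z_+^{2^N}$ with $\sum_{S\ni j}k_S\le\Omega_j$ for all $j$. For $Y\in\mathbb R^{2^N}$ define $\Phi Y=k$ recursively by $k_S=Y_S-\sum_{S'\in R^-(S)}k_{S'}$; this is linear, and $\Phi$ also denotes its matrix. Consider the linear program (with $\infty\cdot0=0$, $S\in2^N$, $q\in[\bar Q]$, $l\in[L]$, $r\in[\bar R]$) $$\text{(SWLP)}\quad \max_{x,y\ge0}\ \sum_{S,q,l}v^l(S,q)x(S,q,l)-\sum_{S,r}\Delta c(S,r)y(S,r)$$ subject to $\sum_S x(S,q,l)\le1$, $\ \sum_{q,l}x(S,q,l)\le(\Phi Y)_S$ where $Y_T=\sum_r y(T,r)$, and $y(S,r)\le1$; and its dual $$\text{(DSWLP)}\quad \min_{b,p,d\ge0}\ \sum_{q,l}b(q,l)+\sum_{S,r}d(S,r)$$ subject to $b(q,l)+p(S)\ge v^l(S,q)$ and $d(S,r)-(\Phi^{\mathsf T}p)_S\ge-\Delta c(S,r)$. For a solution $(x,y)$ of SWLP let $\tilde r_S$ be the largest $r$ with $y(S,r)>0$ ($\tilde r_S=0$ if there is none).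 Say that the steps of $S$ are *allocated in order* if $y(S,r')>0$ implies $y(S,r)=1$ for all $r<r'$ (for integral $y$: $y(S,r)=1$ for $r\le\tilde r_S$ and $y(S,r)=0$ for $r>\tilde r_S$). **Proposition.** Let $(x,y)$ be an optimal solution of SWLP and $(b,p,d)$ an optimal solution of DSWLP. 1. For every $r\in[\bar R]$ and every $S\in2^N$, $\displaystyle p(S)\le\sum_{S'\in R_0^+(S)}\Delta c(S',r)+\sum_{S'\in R_0^+(S)}d(S',r).$ 2. For every $S\in 2^N$ whose steps are allocated in order and every $r\in[\bar R]$ with $r\le\tilde r_S$, $\displaystyle p(S)=\sum_{S'\in R_0^+(S)}\Delta c(S',r)+\sum_{S'\in R_0^+(S)}d(S',r)$ (in particular the right-hand side is finite). 3. The pricing function that charges every agent (the seller or a buyer) $p(k)=\sum_S k_S\,p(S)$ for a package multiset $k$ is uniform (an additional copy of $S$ has the same price whatever else is traded), anonymous (the price of $k$ does not depend on the agent), and package-linear (the price of $k$ is $\sum_S k_S$ times the price of a single copy of $S$). -/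

import Mathlib

open Finset

/-- A package is a subset of the set of varieties `{1, …, n}`. -/
abbrev Package (n : ℕ) := Finset (Fin n)

/-- A package multiset: a multiplicity for every package. -/
abbrev PackageMultiset (n : ℕ) := Package n → ℕ

/-- A cost function graph: a directed graph on the packages, each arc of which leads from a package
to a proper subset, and in which every package is connected by a directed path to every single
variety that it contains. -/
structure CostFunctionGraph (n : ℕ) where
  Arc : Package n → Package n → Prop
  ssubset_of_arc : ∀ T S, Arc T S → S ⊂ T
  path_to_variety : ∀ (S : Package n) (j : Fin n), j ∈ S → Relation.ReflTransGen Arc S {j}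

namespace CostFunctionGraph

variable {n : ℕ} (G : CostFunctionGraph n)

/-- `T` is (cost-)connected to `S`: there is a directed path, possibly of length `0`. -/
def Connected (T S : Package n) : Prop := Relation.ReflTransGen G.Arc T S

theorem Connected.subset {G : CostFunctionGraph n} {T S : Package n} (h : G.Connected T S) :
    S ⊆ T := by
  induction h with
  | refl => exact Finset.Subset.refl _
  | tail _ hbc ih => exact (G.ssubset_of_arc _ _ hbc).subset.trans ih

open Classical in
/-- The successors of `S`, including `S`. -/
noncomputable def successors (S : Package n) : Finset (Package n) :=
  univ.filter fun S' => G.Connected S S'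

open Classical in
/-- The predecessors of `S`, including `S`. -/
noncomputable def predecessors (S : Package n) : Finset (Package n) :=
  univ.filter fun S' => G.Connected S' S

open Classical in
/-- The strict predecessors of `S`. -/
noncomputable def strictPredecessors (S : Package n) : Finset (Package n) :=
  univ.filter fun S' => G.Connected S' S ∧ S' ≠ S

theorem card_compl_lt {S S' : Package n} (h : S' ∈ G.strictPredecessors S) :
    S'ᶜ.card < Sᶜ.card := by
  classical
  simp only [strictPredecessors, mem_filter, mem_univ, true_and] at h
  exact Finset.card_lt_card
    (Finset.compl_ssubset_compl.2 (h.1.subset.ssubset_of_ne h.2.symm))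

/-- The characteristic function of the graph, computed from the sources downwards by
`k_S = Y_S - ∑ k_{S'}`, the sum being over the strict predecessors `S'` of `S`. Here `Y_S` is the
total quantity that is allocated on the incremental cost function of `S`. -/
noncomputable def charFun (Y : Package n → ℝ) (S : Package n) : ℝ :=
  Y S - ∑ S' ∈ (G.strictPredecessors S).attach, charFun Y S'.1
termination_by Sᶜ.card
decreasing_by exact G.card_compl_lt S'.2

theorem charFun_eq (Y : Package n → ℝ) (S : Package n) :
    G.charFun Y S = Y S - ∑ S' ∈ G.strictPredecessors S, G.charFun Y S' := by
  rw [charFun, Finset.sum_attach (G.strictPredecessors S) (fun S' => G.charFun Y S')]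

open Classical in
/-- The matrix of the characteristic function. -/
noncomputable def charMatrix : Matrix (Package n) (Package n) ℝ :=
  Matrix.of fun S T => G.charFun (Pi.single T 1) S

theorem charFun_eq_mulVec (Y : Package n → ℝ) : G.charFun Y = G.charMatrix.mulVec Y := by
  classical
  have key : ∀ (m : ℕ) (S : Package n), Sᶜ.card = m →
      G.charFun Y S = ∑ T, G.charFun (Pi.single T 1) S * Y T := by
    intro m
    induction m using Nat.strong_induction_on with
    | _ m ih =>
      intro S hS
      have h1 : ∀ S' ∈ G.strictPredecessors S,
          G.charFun Y S' = ∑ T, G.charFun (Pi.single T 1) S' * Y T := fun S' hS' =>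
        ih _ (hS ▸ G.card_compl_lt hS') S' rfl
      rw [charFun_eq, Finset.sum_congr rfl h1, Finset.sum_comm]
      have h2 : ∀ T, G.charFun (Pi.single T 1) S * Y T
          = (Pi.single T 1 : Package n → ℝ) S * Y T
            - ∑ S' ∈ G.strictPredecessors S, G.charFun (Pi.single T 1) S' * Y T := by
        intro T
        rw [charFun_eq, sub_mul, Finset.sum_mul]
      rw [Finset.sum_congr rfl (fun T _ => h2 T), Finset.sum_sub_distrib]
      congr 1
      simp [Pi.single_apply]
  funext S
  rw [key _ S rfl]
  simp only [charMatrix, Matrix.mulVec, dotProduct, Matrix.of_apply]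

/-- The characteristic function dual: the transposed matrix applied to package prices. -/
noncomputable def charDual (p : Package n → ℝ) : Package n → ℝ :=
  G.charMatrix.transpose.mulVec p

end CostFunctionGraph

/-- A market with packaging costs: `n` varieties with `Ω j` units of variety `j`, `L` buyers, each
of whom consists of finitely many unit-demand agents, and a seller whose costs are given by a cost
function graph and by incremental costs with values in `ℤ ∪ {∞}`. Steps `r` and unit-demand agents
`q` are numbered from `1`. -/
structure Market (n L : ℕ) where
  Ω : Fin n → ℕ
  /-- the number of unit-demand agents of a buyer -/
  numAgents : Fin L → ℕ
  /-- `v l S q` is the value of package `S` for the `q`-th unit-demand agent of buyer `l` -/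
  v : Fin L → Package n → ℕ → ℕ
  v_eq_zero : ∀ l S q, numAgents l < q → v l S q = 0
  G : CostFunctionGraph n
  /-- `Δc S r` is the height of step `r` of the incremental cost function of `S` -/
  Δc : Package n → ℕ → WithTop ℤ
  Δc_singleton : ∀ j r, Ω j < r → Δc {j} r = ⊤
  Δc_mono : ∀ S r, 1 ≤ r → Δc S r ≤ Δc S (r + 1)
  finitely_many_steps : ∃ R, ∀ S r, R < r → Δc S r = ⊤
  /-- the cost of every feasible package multiset is non-negative -/
  cost_nonneg : ∀ k : PackageMultiset n, (∀ j, ∑ S, (if j ∈ S then k S else 0) ≤ Ω j) →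
    0 ≤ ∑ S, ∑ r ∈ Icc 1 (∑ S' ∈ G.predecessors S, k S'), Δc S r

/-- The inclusion of `ℤ ∪ {∞}` in the extended real numbers. -/
noncomputable def costToEReal (c : WithTop ℤ) : EReal :=
  WithTop.recTopCoe (⊤ : EReal) (fun z : ℤ => ((z : ℝ) : EReal)) c

namespace Market

variable {n L : ℕ} (M : Market n L)

/-- The largest number of unit-demand agents of a buyer. -/
def maxAgents : ℕ := univ.sup M.numAgents

/-- The last step at which some incremental cost function is finite (`0` if there is none). -/
noncomputable def maxStep : ℕ := sSup {r | 1 ≤ r ∧ ∃ S, M.Δc S r ≠ ⊤}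

/-- The indices `1, …, maxAgents`. -/
abbrev Agent := {q : ℕ // q ∈ Icc 1 M.maxAgents}

/-- The indices `1, …, maxStep`. -/
abbrev Step := {r : ℕ // r ∈ Icc 1 M.maxStep}

/-- Incremental costs as extended real numbers. -/
noncomputable def incCost (S : Package n) (r : ℕ) : EReal := costToEReal (M.Δc S r)

/-- Feasibility in the linear programming relaxation of welfare maximization. -/
structure PrimalFeasible (x : Package n → M.Agent → Fin L → ℝ) (y : Package n → M.Step → ℝ) :
    Prop where
  agent : ∀ (q : M.Agent) (l : Fin L), ∑ S, x S q l ≤ 1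
  supply : ∀ S, (∑ q : M.Agent, ∑ l, x S q l) - M.G.charFun (fun T => ∑ r : M.Step, y T r) S ≤ 0
  y_le_one : ∀ S r, y S r ≤ 1
  x_nonneg : ∀ S q l, 0 ≤ x S q l
  y_nonneg : ∀ S r, 0 ≤ y S r

/-- The objective of the relaxation, with `∞ · 0 = 0` and `∞ · t = ∞` for `t > 0`. -/
noncomputable def primalValue (x : Package n → M.Agent → Fin L → ℝ)
    (y : Package n → M.Step → ℝ) : EReal :=
  ((∑ S, ∑ q : M.Agent, ∑ l, (M.v l S q : ℝ) * x S q l : ℝ) : EReal)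
    - ∑ S, ∑ r : M.Step, M.incCost S r * ((y S r : ℝ) : EReal)

/-- An optimal solution of the relaxation. -/
structure PrimalOptimal (x : Package n → M.Agent → Fin L → ℝ) (y : Package n → M.Step → ℝ) :
    Prop where
  feasible : M.PrimalFeasible x y
  optimal : ∀ x' y', M.PrimalFeasible x' y' → M.primalValue x' y' ≤ M.primalValue x y

/-- Feasibility in the dual linear program. -/
structure DualFeasible (b : M.Agent → Fin L → ℝ) (p : Package n → ℝ)
    (d : Package n → M.Step → ℝ) : Prop where
  buyer : ∀ (S : Package n) (q : M.Agent) (l : Fin L), (M.v l S q : ℝ) ≤ b q l + p S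
  seller : ∀ (S : Package n) (r : M.Step), -M.incCost S r ≤ ((d S r - M.G.charDual p S : ℝ) : EReal)
  b_nonneg : ∀ q l, 0 ≤ b q l
  d_nonneg : ∀ S r, 0 ≤ d S r
  p_nonneg : ∀ S, 0 ≤ p S

/-- The objective of the dual linear program. -/
noncomputable def dualValue (b : M.Agent → Fin L → ℝ) (d : Package n → M.Step → ℝ) : ℝ :=
  (∑ q, ∑ l, b q l) + ∑ S, ∑ r, d S r

/-- An optimal solution of the dual linear program. -/
structure DualOptimal (b : M.Agent → Fin L → ℝ) (p : Package n → ℝ)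
    (d : Package n → M.Step → ℝ) : Prop where
  feasible : M.DualFeasible b p d
  optimal : ∀ b' p' d', M.DualFeasible b' p' d' → M.dualValue b d ≤ M.dualValue b' d'

open Classical in
/-- The last step of the incremental cost function of `S` on which a positive quantity is
allocated, and `0` if nothing is allocated. -/
noncomputable def lastStep (y : Package n → M.Step → ℝ) (S : Package n) : ℕ :=
  (univ.filter fun r => 0 < y S r).sup fun r => (r : ℕ)

/-- The steps of the incremental cost function of `S` are allocated in order: a step receives
something only if all earlier steps are allocated completely. For integral `y` this says that
`y S r = 1` up to some step and `y S r = 0` thereafter. -/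
def AllocatedInOrder (y : Package n → M.Step → ℝ) (S : Package n) : Prop :=
  ∀ r r' : M.Step, r < r' → 0 < y S r' → y S r = 1

end Market

/-- The price `p(k) = ∑ k_S p(S)` at which agent `a` trades the package multiset `k`; agent `0` is
the seller and `1, …, L` are the buyers. -/
noncomputable def priceOf {n : ℕ} (L : ℕ) (p : Package n → ℝ) (_a : Fin (L + 1))
    (k : PackageMultiset n) : ℝ :=
  ∑ S, (k S : ℝ) * p S

open Classical in
/-- The package multiset that consists of one copy of `S`. -/
noncomputable def singlePackage {n : ℕ} (S : Package n) : PackageMultiset n := Pi.single S 1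

/-- Every agent's price of a multiset is the sum of that agent's prices of its packages. -/
def IsPackageLinear {n L : ℕ} (P : Fin (L + 1) → PackageMultiset n → ℝ) : Prop :=
  ∀ a k, P a k = ∑ S, (k S : ℝ) * P a (singlePackage S)

/-- Prices do not depend on who trades. -/
def IsAnonymous {n L : ℕ} (P : Fin (L + 1) → PackageMultiset n → ℝ) : Prop :=
  ∀ a a' k, P a k = P a' k

/-- All copies of a package have the same price: what an agent pays for one more copy of `S` does
not depend on what else the agent trades. -/
def IsUniform {n L : ℕ} (P : Fin (L + 1) → PackageMultiset n → ℝ) : Prop :=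
  ∀ a S k k', P a (k + singlePackage S) - P a k = P a (k' + singlePackage S) - P a k'

/-! The recursion defining `Φ` says that `Y_S` is the sum of `ΦY` over the predecessors of `S`.
Transposing this inverse, `p(S)` is the sum of `Φᵀp` over the successors of `S`. Dual feasibility
bounds each `(Φᵀp)_T` by `Δc(T,r) + d(T,r)`, and summing gives the upper bound on `p(S)`.

For equality, every summand must be tight. Since `ΦY ≥ 0`, the totals `Y` grow along directed paths,
so a successor `T` of a package filled in order through step `r` receives a positive quantity at
some step `r' ≥ r`. Complementary slackness makes `T` tight at `r'`. If `y(T,r) > 0`, it is tight at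
`r` as well; if `y(T,r) = 0`, then `d(T,r) = 0`, and `Δc(T,r) ≤ Δc(T,r')` closes the gap.

Complementary slackness needs strong duality, derived here from Farkas' lemma after the steps of
infinite cost have been removed. The claims on the pricing function follow from its additivity. -/

/-! ### Farkas' lemma and linear programming multipliers -/

/-- **Farkas' lemma** for finitely many linear functionals on a real vector space. -/
theorem farkas_finset {ι W : Type*} [AddCommGroup W] [Module ℝ W] (s : Finset ι) :
    ∀ (a : ι → W →ₗ[ℝ] ℝ) (c : W →ₗ[ℝ] ℝ),
      (∀ z, (∀ j ∈ s, a j z ≤ 0) → c z ≤ 0) →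
      ∃ u : ι → ℝ, (∀ j, 0 ≤ u j) ∧ ∀ z, c z = ∑ j ∈ s, u j * a j z := by
  classical
  induction s using Finset.induction_on with
  | empty =>
    intro a c h
    refine ⟨0, fun _ => le_rfl, fun z => ?_⟩
    have h1 := h z (by simp)
    have h2 := h (-z) (by simp)
    rw [map_neg] at h2
    simp only [sum_empty]
    linarith
  | insert k s hk ih =>
    intro a c h
    -- Either constraint `k` is redundant and gets multiplier 0, or some point violates the
    -- implication without it.
    by_cases hc : ∀ z, (∀ j ∈ s, a j z ≤ 0) → c z ≤ 0
    · obtain ⟨u, hu, hcu⟩ := ih a c hc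
      refine ⟨Function.update u k 0, fun j => ?_, fun z => ?_⟩
      · by_cases hj : j = k
        · simp [hj]
        · simpa [hj] using hu j
      · rw [sum_insert hk, hcu z]
        simp only [Function.update_self, zero_mul, zero_add]
        refine sum_congr rfl fun j hj => ?_
        rw [Function.update_of_ne (ne_of_mem_of_not_mem hj hk)]
    · push Not at hc
      obtain ⟨z₀, hz₀, hcz₀⟩ := hc
      have hak : 0 < a k z₀ := by
        by_contra hle
        refine (h z₀ fun j hj => ?_).not_gt hcz₀
        rcases mem_insert.1 hj with rfl | hj
        exacts [not_lt.1 hle, hz₀ j hj]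
      obtain ⟨w, hw, hkw, hcw⟩ : ∃ w, (∀ j ∈ s, a j w ≤ 0) ∧ a k w = 1 ∧ 0 < c w := by
        refine ⟨(a k z₀)⁻¹ • z₀, fun j hj => ?_, ?_, ?_⟩
        · simpa using mul_nonpos_of_nonneg_of_nonpos (inv_nonneg.2 hak.le) (hz₀ j hj)
        · simp [hak.ne']
        · simpa using mul_pos (inv_pos.2 hak) hcz₀
      -- All functionals are composed with `z ↦ z - a k z • w`, the projection onto the kernel of `a
      -- k` along `w`; this eliminates constraint `k`.
      obtain ⟨u, hu, hcu⟩ := ih (fun j => a j - a j w • a k) (c - c w • a k) fun z hz => by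
        have := h (z - a k z • w) fun j hj => by
          rcases mem_insert.1 hj with rfl | hj
          · simp [hkw]
          · have := hz j hj
            simp only [LinearMap.sub_apply, LinearMap.smul_apply, smul_eq_mul] at this
            simp only [map_sub, map_smul, smul_eq_mul]
            linarith
        simp only [map_sub, map_smul, smul_eq_mul] at this
        simp only [LinearMap.sub_apply, LinearMap.smul_apply, smul_eq_mul]
        linarith
      -- The multiplier of `k` is forced by evaluating the desired identity at `w`, where `a k w =
      -- 1`. It is nonnegative as `c w > 0` and `a j w ≤ 0`.
      refine ⟨Function.update u k (c w - ∑ j ∈ s, u j * a j w), fun j => ?_, fun z => ?_⟩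
      · by_cases hj : j = k
        · subst hj
          have := sum_nonpos fun j hj => mul_nonpos_of_nonneg_of_nonpos (hu j) (hw j hj)
          simp only [Function.update_self]
          linarith
        · simpa [hj] using hu j
      · have h1 := hcu z
        have h2 : ∑ j ∈ s, Function.update u k (c w - ∑ j ∈ s, u j * a j w) j * a j z
            = ∑ j ∈ s, u j * a j z := sum_congr rfl fun j hj => by
          rw [Function.update_of_ne (ne_of_mem_of_not_mem hj hk)]
        rw [sum_insert hk, h2, Function.update_self]
        simp only [LinearMap.sub_apply, LinearMap.smul_apply, smul_eq_mul, mul_sub,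
          sum_sub_distrib] at h1
        rw [sub_mul, sum_mul]
        simp only [mul_assoc] at h1 ⊢
        linarith

/-- Lagrange multipliers of a linear program: the objective at an optimal point is a nonnegative
combination of the constraints that are active there. -/
theorem exists_multipliers_of_optimal {ι W : Type*} [Fintype ι] [AddCommGroup W] [Module ℝ W]
    (a : ι → W →ₗ[ℝ] ℝ) (β : ι → ℝ) (c : W →ₗ[ℝ] ℝ) (z : W) (hz : ∀ j, a j z ≤ β j)
    (hopt : ∀ z', (∀ j, a j z' ≤ β j) → c z' ≤ c z) :
    ∃ u : ι → ℝ, (∀ j, 0 ≤ u j) ∧ (∀ w, c w = ∑ j, u j * a j w) ∧ c z = ∑ j, u j * β j := by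
  classical
  -- A direction that increases no active constraint stays feasible for a short step, so by
  -- optimality it cannot increase `c`.
  obtain ⟨u, hu, hcu⟩ := farkas_finset (univ.filter fun j => a j z = β j) a c fun w hw => by
    have hε : ∀ j, ∃ ε : ℝ, 0 < ε ∧ ∀ t, 0 ≤ t → t ≤ ε → a j (z + t • w) ≤ β j := by
      intro j
      simp only [map_add, map_smul, smul_eq_mul]
      by_cases hj : a j z = β j
      · refine ⟨1, one_pos, fun t ht _ => ?_⟩
        have := mul_nonpos_of_nonneg_of_nonpos ht (hw j (by simp [hj]))
        linarith
      · have hlt : 0 < β j - a j z := sub_pos.2 (lt_of_le_of_ne (hz j) hj)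
        have hpos : 0 < |a j w| + 1 := by positivity
        -- The step length is slack over slope; the `+ 1` keeps the denominator positive.
        refine ⟨(β j - a j z) / (|a j w| + 1), div_pos hlt hpos, fun t ht hle => ?_⟩
        rw [le_div_iff₀ hpos] at hle
        have := mul_le_mul_of_nonneg_left ((le_abs_self (a j w)).trans (le_add_of_nonneg_right
          zero_le_one)) ht
        linarith
    choose ε hε0 hε using hε
    obtain ⟨t, ht0, ht⟩ : ∃ t : ℝ, 0 < t ∧ ∀ j, t ≤ ε j := by
      rcases isEmpty_or_nonempty ι with hι | hι
      · exact ⟨1, one_pos, fun j => hι.elim j⟩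
      · obtain ⟨j, -, hj⟩ := exists_min_image univ ε univ_nonempty
        exact ⟨ε j, hε0 j, fun i => hj i (mem_univ i)⟩
    have := hopt (z + t • w) fun j => hε j t ht0.le (ht j)
    simp only [map_add, map_smul, smul_eq_mul] at this
    exact nonpos_of_mul_nonpos_right (by linarith) ht0
  refine ⟨fun j => if a j z = β j then u j else 0, fun j => ?_, fun w => ?_, ?_⟩
  · dsimp only
    split_ifs
    exacts [hu j, le_rfl]
  · rw [hcu w, sum_filter]
    exact sum_congr rfl fun j _ => by split_ifs with h <;> simp [h]
  · rw [hcu z, sum_filter]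
    exact sum_congr rfl fun j _ => by split_ifs with h <;> simp [h]

/-! ### Inverting the characteristic function and its dual -/

namespace CostFunctionGraph

variable {n : ℕ} (G : CostFunctionGraph n)

theorem charFun_zero : G.charFun (fun _ => 0) = 0 := by
  rw [charFun_eq_mulVec]
  exact Matrix.mulVec_zero _

theorem sum_predecessors_charFun (Y : Package n → ℝ) (S : Package n) :
    ∑ S' ∈ G.predecessors S, G.charFun Y S' = Y S := by
  classical
  have h : G.predecessors S = insert S (G.strictPredecessors S) := by
    ext T
    simp only [predecessors, strictPredecessors, mem_filter, mem_univ, true_and, mem_insert]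
    constructor
    · exact fun hT => or_iff_not_imp_left.2 fun hne => ⟨hT, hne⟩
    · rintro (rfl | hT)
      exacts [Relation.ReflTransGen.refl, hT.1]
  rw [h, sum_insert (by simp [strictPredecessors]), G.charFun_eq Y S]
  ring

/-- Adjointness of `Φ` and `Φᵀ`. -/
theorem sum_charDual_mul (p Y : Package n → ℝ) :
    ∑ S, G.charDual p S * Y S = ∑ S, p S * G.charFun Y S := by
  rw [charFun_eq_mulVec, charDual]
  change Matrix.mulVec _ p ⬝ᵥ Y = p ⬝ᵥ Matrix.mulVec _ Y
  rw [Matrix.mulVec_transpose, Matrix.dotProduct_mulVec]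

/-- The price of a package is the sum of the dual characteristic function over its successors. -/
theorem sum_successors_charDual (p : Package n → ℝ) (S : Package n) :
    ∑ S' ∈ G.successors S, G.charDual p S' = p S := by
  classical
  -- The indicator of the successors of `S` is the preimage of the unit vector at `S` under `Φ`;
  -- pairing it with `Φᵀp` isolates `p S`.
  set Y : Package n → ℝ := fun T => if G.Connected S T then 1 else 0 with hY
  have hk : G.charFun Y = Pi.single S 1 := by
    funext T
    generalize hm : Tᶜ.card = m
    induction m using Nat.strong_induction_on generalizing T with
    | _ m ih =>
      have hsum : ∑ T' ∈ G.strictPredecessors T, G.charFun Y T'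
          = if S ∈ G.strictPredecessors T then 1 else 0 := by
        rw [sum_congr rfl fun T' hT' => ih _ (hm ▸ G.card_compl_lt hT') T' rfl]
        simp [Pi.single_apply]
      rw [charFun_eq, hsum]
      by_cases hTS : T = S
      · subst hTS
        have hmem : T ∉ G.strictPredecessors T := by simp [strictPredecessors]
        simp [hY, hmem, Connected, Relation.ReflTransGen.refl]
      · simp [hY, strictPredecessors, hTS, Ne.symm hTS]
  have := G.sum_charDual_mul p Y
  rw [hk] at this
  simp only [hY, mul_ite, mul_one, mul_zero, Pi.single_apply] at this
  rw [← sum_filter] at this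
  simpa [successors] using this

/-- Predecessors of `S` are also predecessors of `T`, so `Y T` sums nonnegative terms over a larger
set. -/
theorem le_of_charFun_nonneg {Y : Package n → ℝ} (hY : ∀ S, 0 ≤ G.charFun Y S)
    {S T : Package n} (h : G.Connected S T) : Y S ≤ Y T := by
  rw [← G.sum_predecessors_charFun Y S, ← G.sum_predecessors_charFun Y T]
  refine sum_le_sum_of_subset_of_nonneg (fun S' hS' => ?_) fun S' _ _ => hY S'
  simp only [predecessors, mem_filter, mem_univ, true_and] at hS' ⊢
  exact hS'.trans h

end CostFunctionGraph

/-! ### Finite sums of extended reals -/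

theorem EReal.coe_finset_sum {ι : Type*} (s : Finset ι) (f : ι → ℝ) :
    ((∑ i ∈ s, f i : ℝ) : EReal) = ∑ i ∈ s, (f i : EReal) := by
  classical
  induction s using Finset.induction_on with
  | empty => simp
  | insert k s hk ih => rw [sum_insert hk, sum_insert hk, EReal.coe_add, ih]

theorem EReal.finset_sum_ne_bot {ι : Type*} {s : Finset ι} {f : ι → EReal}
    (h : ∀ i ∈ s, f i ≠ ⊥) : ∑ i ∈ s, f i ≠ ⊥ := by
  classical
  induction s using Finset.induction_on with
  | empty => simp
  | insert k s hk ih =>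
    rw [sum_insert hk, EReal.add_ne_bot_iff]
    exact ⟨h k (mem_insert_self _ _), ih fun i hi => h i (mem_insert_of_mem hi)⟩

theorem EReal.finset_sum_eq_top {ι : Type*} {s : Finset ι} {f : ι → EReal}
    (h : ∀ i ∈ s, f i ≠ ⊥) {k : ι} (hk : k ∈ s) (htop : f k = ⊤) : ∑ i ∈ s, f i = ⊤ := by
  classical
  rw [← add_sum_erase s f hk, htop]
  exact EReal.top_add_of_ne_bot (EReal.finset_sum_ne_bot fun i hi => h i (mem_of_mem_erase hi))

/-! ### Strong duality and complementary slackness -/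

namespace Market

variable {n L : ℕ} (M : Market n L)

/-- The real value of a finite incremental cost, and `0` for an infinite one. -/
noncomputable def realCost (S : Package n) (r : ℕ) : ℝ := ((M.Δc S r).untopD 0 : ℤ)

theorem incCost_of_ne_top {S : Package n} {r : ℕ} (h : M.Δc S r ≠ ⊤) :
    M.incCost S r = (M.realCost S r : EReal) := by
  obtain ⟨z, hz⟩ := WithTop.ne_top_iff_exists.1 h
  rw [incCost, realCost, ← hz]
  rfl

theorem incCost_of_eq_top {S : Package n} {r : ℕ} (h : M.Δc S r = ⊤) : M.incCost S r = ⊤ := by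
  rw [incCost, h]
  rfl

theorem realCost_le_realCost {S : Package n} {r r' : ℕ} (h : M.Δc S r ≤ M.Δc S r')
    (h' : M.Δc S r' ≠ ⊤) : M.realCost S r ≤ M.realCost S r' := by
  obtain ⟨z, hz⟩ := WithTop.ne_top_iff_exists.1 (ne_top_of_le_ne_top h' h)
  obtain ⟨z', hz'⟩ := WithTop.ne_top_iff_exists.1 h'
  rw [← hz, ← hz', WithTop.coe_le_coe] at h
  rw [realCost, realCost, ← hz, ← hz']
  exact Int.cast_le.2 h

theorem delta_le_of_le {S : Package n} {r r' : ℕ} (hr : 1 ≤ r) (h : r ≤ r') :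
    M.Δc S r ≤ M.Δc S r' := by
  induction r', h using Nat.le_induction with
  | base => exact le_rfl
  | succ m hm ih => exact ih.trans (M.Δc_mono S m (hr.trans hm))

/-- The objective of the relaxation when nothing is allocated on steps of infinite cost. -/
noncomputable def realValue (x : Package n → M.Agent → Fin L → ℝ) (y : Package n → M.Step → ℝ) :
    ℝ :=
  (∑ S, ∑ q : M.Agent, ∑ l, (M.v l S q : ℝ) * x S q l)
    - ∑ S, ∑ r : M.Step, M.realCost S r * y S r

theorem primalValue_eq_realValue (x : Package n → M.Agent → Fin L → ℝ)
    {y : Package n → M.Step → ℝ} (hy : ∀ S (r : M.Step), M.Δc S r = ⊤ → y S r = 0) :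
    M.primalValue x y = (M.realValue x y : EReal) := by
  rw [primalValue, realValue, EReal.coe_sub]
  congr 1
  simp only [EReal.coe_finset_sum]
  refine sum_congr rfl fun S _ => sum_congr rfl fun r _ => ?_
  by_cases h : M.Δc S r = ⊤
  · simp [hy S r h]
  · rw [M.incCost_of_ne_top h, EReal.coe_mul]

variable {M} in
/-- An optimal solution allocates nothing on steps of infinite cost. -/
theorem PrimalOptimal.eq_zero_of_eq_top {x : Package n → M.Agent → Fin L → ℝ}
    {y : Package n → M.Step → ℝ} (hxy : M.PrimalOptimal x y) (S : Package n) (r : M.Step)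
    (hS : M.Δc S r = ⊤) : y S r = 0 := by
  by_contra hne
  have hpos : 0 < y S r := lt_of_le_of_ne (hxy.feasible.y_nonneg S r) (Ne.symm hne)
  -- In `EReal`, `⊤ + ⊥ = ⊥`, so an infinite term dominates the sum only if no term is `⊥`.
  have hbot : ∀ T (t : M.Step), M.incCost T t * ((y T t : ℝ) : EReal) ≠ ⊥ := by
    intro T t
    by_cases h : M.Δc T t = ⊤
    · rw [M.incCost_of_eq_top h]
      rcases (hxy.feasible.y_nonneg T t).eq_or_lt with h0 | h0
      · simp [← h0]
      · simp [EReal.top_mul_coe_of_pos h0]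
    · rw [M.incCost_of_ne_top h, ← EReal.coe_mul]
      exact EReal.coe_ne_bot _
  have hval : M.primalValue x y = ⊥ := by
    rw [primalValue, EReal.finset_sum_eq_top (fun T _ => EReal.finset_sum_ne_bot fun t _ => hbot T t)
      (mem_univ S) (EReal.finset_sum_eq_top (fun t _ => hbot S t) (mem_univ r) ?_)]
    · exact EReal.sub_top _
    · rw [M.incCost_of_eq_top hS, EReal.top_mul_coe_of_pos hpos]
  -- Allocating nothing has finite value and beats `⊥`.
  have hfeas : M.PrimalFeasible 0 0 :=
    ⟨by simp, by simp [M.G.charFun_zero], by simp, by simp, by simp⟩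
  have := hxy.optimal 0 0 hfeas
  rw [hval, M.primalValue_eq_realValue 0 (y := 0) (by simp)] at this
  simp at this

variable {M} in
/-- Strong duality: some dual feasible point has the value of a given optimal solution. -/
theorem PrimalOptimal.exists_dualFeasible {x : Package n → M.Agent → Fin L → ℝ}
    {y : Package n → M.Step → ℝ} (hxy : M.PrimalOptimal x y) :
    ∃ b p d, M.DualFeasible b p d ∧ M.dualValue b d = M.realValue x y := by
  classical
  let W := (Package n → M.Agent → Fin L → ℝ) × (Package n → M.Step → ℝ)
  let X : Package n → M.Agent → Fin L → W →ₗ[ℝ] ℝ := fun S q l =>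
    LinearMap.proj l ∘ₗ LinearMap.proj q ∘ₗ LinearMap.proj S ∘ₗ LinearMap.fst ℝ _ _
  let Y : Package n → M.Step → W →ₗ[ℝ] ℝ := fun S r =>
    LinearMap.proj r ∘ₗ LinearMap.proj S ∘ₗ LinearMap.snd ℝ _ _
  have hX : ∀ S q l (w : W), X S q l w = w.1 S q l := fun _ _ _ _ => rfl
  have hY : ∀ S r (w : W), Y S r w = w.2 S r := fun _ _ _ => rfl
  let K : Package n → W →ₗ[ℝ] ℝ := fun S => ∑ T, M.G.charMatrix S T • ∑ r, Y T r
  have hK : ∀ S (w : W), K S w = M.G.charFun (fun T => ∑ r, w.2 T r) S := by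
    intro S w
    rw [M.G.charFun_eq_mulVec]
    simp [K, hY, Matrix.mulVec, dotProduct]
  let c : W →ₗ[ℝ] ℝ :=
    (∑ S, ∑ q : M.Agent, ∑ l, (M.v l S q : ℝ) • X S q l) - ∑ S, ∑ r : M.Step, M.realCost S r • Y S r
  have hc : ∀ w : W, c w = M.realValue w.1 w.2 := by
    intro w
    simp [c, hX, hY, realValue]
  -- Capacity 0 on steps of infinite cost gives a program with real costs; the value 0 of `realCost`
  -- there is then harmless.
  let β₃ : Package n × M.Step → ℝ := fun i => if M.Δc i.1 i.2 = ⊤ then 0 else 1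
  let β : (M.Agent × Fin L) ⊕ Package n ⊕ (Package n × M.Step) ⊕
      (Package n × M.Agent × Fin L) ⊕ (Package n × M.Step) → ℝ :=
    Sum.elim (fun _ => 1) (Sum.elim (fun _ => 0) (Sum.elim β₃
      (Sum.elim (fun _ => 0) fun _ => 0)))
  let a : (M.Agent × Fin L) ⊕ Package n ⊕ (Package n × M.Step) ⊕
      (Package n × M.Agent × Fin L) ⊕ (Package n × M.Step) → W →ₗ[ℝ] ℝ :=
    Sum.elim (fun i => ∑ S, X S i.1 i.2) (Sum.elim (fun S => (∑ q, ∑ l, X S q l) - K S)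
      (Sum.elim (fun i => Y i.1 i.2) (Sum.elim (fun i => -X i.1 i.2.1 i.2.2) fun i => -Y i.1 i.2)))
  have hfeas : ∀ w : W, (∀ j, a j w ≤ β j) ↔
      M.PrimalFeasible w.1 w.2 ∧ ∀ S (r : M.Step), M.Δc S r = ⊤ → w.2 S r = 0 := by
    intro w
    simp only [Sum.forall, Prod.forall, a, β, β₃, Sum.elim_inl, Sum.elim_inr,
      LinearMap.sum_apply, LinearMap.sub_apply, LinearMap.neg_apply, hX, hY, hK, neg_nonpos]
    constructor
    · rintro ⟨h1, h2, h3, h4, h5⟩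
      refine ⟨⟨h1, h2, fun S r => (h3 S r).trans ?_, h4, h5⟩, fun S r hSr => ?_⟩
      · split_ifs <;> norm_num
      · have := h3 S r
        rw [if_pos hSr] at this
        exact le_antisymm this (h5 S r)
    · rintro ⟨⟨h1, h2, h3, h4, h5⟩, h6⟩
      refine ⟨h1, h2, fun S r => ?_, h4, h5⟩
      split_ifs with hSr
      exacts [(h6 S r hSr).le, h3 S r]
  have hz := (hfeas (x, y)).2 ⟨hxy.feasible, hxy.eq_zero_of_eq_top⟩
  obtain ⟨u, hu, hcu, hval⟩ := exists_multipliers_of_optimal a β c (x, y) hz fun w hw => by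
    obtain ⟨hw1, hw2⟩ := (hfeas w).1 hw
    have := hxy.optimal _ _ hw1
    rw [M.primalValue_eq_realValue _ hw2, M.primalValue_eq_realValue _ hxy.eq_zero_of_eq_top]
      at this
    rw [hc, hc]
    exact_mod_cast this
  simp only [Fintype.sum_sum_type, Fintype.sum_prod_type, a, β, β₃, Sum.elim_inl, Sum.elim_inr,
    LinearMap.sum_apply, LinearMap.sub_apply, LinearMap.neg_apply, hX, hY, hK, hc] at hcu hval
  -- The dual point consists of the multipliers of the first three blocks. Resetting `d` to 0 on
  -- infinite steps is free: the seller constraint is void there and the capacity 0 contributes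
  -- nothing to the objective.
  refine ⟨fun q l => u (Sum.inl (q, l)), fun S => u (Sum.inr (Sum.inl S)),
    fun S r => if M.Δc S r = ⊤ then 0 else u (Sum.inr (Sum.inr (Sum.inl (S, r)))),
    ⟨fun S q l => ?_, fun S r => ?_, fun q l => hu _, fun S r => ?_, fun S => hu _⟩, ?_⟩
  -- Evaluation at a unit vector gives the dual constraint, with the multiplier of the sign
  -- constraint as its slack.
  · have h := hcu (fun T t k => if T = S then if t = q then if k = l then 1 else 0 else 0 else 0, 0)
    simp [realValue, M.G.charFun_zero] at h
    have := hu (Sum.inr (Sum.inr (Sum.inr (Sum.inl (S, q, l)))))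
    linarith
  · by_cases hS : M.Δc S r = ⊤
    · simp [M.incCost_of_eq_top hS]
    · have h := hcu (0, fun T t => if T = S then if t = r then 1 else 0 else 0)
      simp only [mul_sub, sum_sub_distrib, ← M.G.sum_charDual_mul] at h
      simp [realValue] at h
      have := hu (Sum.inr (Sum.inr (Sum.inr (Sum.inr (S, r)))))
      rw [if_neg hS, M.incCost_of_ne_top hS, ← EReal.coe_neg, EReal.coe_le_coe_iff]
      linarith
  · split_ifs
    exacts [le_rfl, hu _]
  · rw [hval, dualValue]
    simp

variable {M} in
/-- Complementary slackness for the steps. -/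
theorem PrimalOptimal.complementary_slackness {x : Package n → M.Agent → Fin L → ℝ}
    {y : Package n → M.Step → ℝ} (hxy : M.PrimalOptimal x y)
    {b : M.Agent → Fin L → ℝ} {p : Package n → ℝ} {d : Package n → M.Step → ℝ}
    (hbpd : M.DualOptimal b p d) (S : Package n) (r : M.Step) :
    d S r * (1 - y S r) = 0 ∧ (d S r - M.G.charDual p S + M.realCost S r) * y S r = 0 := by
  obtain ⟨b', p', d', hfeas', hval'⟩ := hxy.exists_dualFeasible
  have hle := hval' ▸ hbpd.optimal b' p' d' hfeas'
  have hP := hxy.feasible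
  have hD := hbpd.feasible
  have h1 : ∀ q ∈ univ, 0 ≤ ∑ l, b q l * (1 - ∑ S, x S q l) := fun q _ =>
    sum_nonneg fun l _ => mul_nonneg (hD.b_nonneg q l) (sub_nonneg.2 (hP.agent q l))
  have h2 : ∀ S ∈ univ, 0 ≤ p S * (M.G.charFun (fun T => ∑ r : M.Step, y T r) S
      - ∑ q : M.Agent, ∑ l, x S q l) := fun S _ =>
    mul_nonneg (hD.p_nonneg S) (by linarith [hP.supply S])
  have h3' : ∀ S, ∀ r ∈ univ, 0 ≤ d S r * (1 - y S r) := fun S r _ =>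
    mul_nonneg (hD.d_nonneg S r) (sub_nonneg.2 (hP.y_le_one S r))
  have h3 : ∀ S ∈ univ, 0 ≤ ∑ r, d S r * (1 - y S r) := fun S _ => sum_nonneg (h3' S)
  have h4 : ∀ S ∈ univ, 0 ≤ ∑ q : M.Agent, ∑ l, (b q l + p S - M.v l S q) * x S q l := fun S _ =>
    sum_nonneg fun q _ => sum_nonneg fun l _ =>
      mul_nonneg (sub_nonneg.2 (hD.buyer S q l)) (hP.x_nonneg S q l)
  have h5' : ∀ S, ∀ r ∈ univ, 0 ≤ (d S r - M.G.charDual p S + M.realCost S r) * y S r := by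
    intro S r _
    by_cases h : M.Δc S r = ⊤
    · simp [hxy.eq_zero_of_eq_top S r h]
    · have := hD.seller S r
      rw [M.incCost_of_ne_top h, ← EReal.coe_neg, EReal.coe_le_coe_iff] at this
      exact mul_nonneg (by linarith) (hP.y_nonneg S r)
  have h5 : ∀ S ∈ univ, 0 ≤ ∑ r : M.Step, (d S r - M.G.charDual p S + M.realCost S r) * y S r :=
    fun S _ => sum_nonneg (h5' S)
  have hdual := M.G.sum_charDual_mul p fun T => ∑ r : M.Step, y T r
  have hswap : ∑ S, ∑ q : M.Agent, ∑ l, b q l * x S q l = ∑ q, ∑ l, ∑ S, b q l * x S q l := by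
    rw [sum_comm]
    exact sum_congr rfl fun q _ => sum_comm
  -- The duality gap splits into five nonnegative sums of constraint slack times variable. The gap
  -- is at most 0, so every term vanishes.
  have hgap : (∑ q, ∑ l, b q l * (1 - ∑ S, x S q l))
      + (∑ S, p S * (M.G.charFun (fun T => ∑ r : M.Step, y T r) S
        - ∑ q : M.Agent, ∑ l, x S q l))
      + (∑ S, ∑ r, d S r * (1 - y S r))
      + (∑ S, ∑ q : M.Agent, ∑ l, (b q l + p S - M.v l S q) * x S q l)
      + (∑ S, ∑ r : M.Step, (d S r - M.G.charDual p S + M.realCost S r) * y S r)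
      = M.dualValue b d - M.realValue x y := by
    simp only [dualValue, realValue, mul_sub, sub_mul, add_mul, mul_one, sum_sub_distrib,
      sum_add_distrib, mul_sum] at hdual ⊢
    rw [hswap, hdual]
    ring
  have s1 := sum_nonneg h1
  have s2 := sum_nonneg h2
  have s3 := sum_nonneg h3
  have s4 := sum_nonneg h4
  have s5 := sum_nonneg h5
  constructor
  · exact (sum_eq_zero_iff_of_nonneg (h3' S)).1
      ((sum_eq_zero_iff_of_nonneg h3).1 (by linarith) S (mem_univ S)) r (mem_univ r)
  · exact (sum_eq_zero_iff_of_nonneg (h5' S)).1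
      ((sum_eq_zero_iff_of_nonneg h5).1 (by linarith) S (mem_univ S)) r (mem_univ r)

theorem charDual_le_incCost_add {b : M.Agent → Fin L → ℝ} {p : Package n → ℝ}
    {d : Package n → M.Step → ℝ} (h : M.DualFeasible b p d) (S : Package n) (r : M.Step) :
    ((M.G.charDual p S : ℝ) : EReal) ≤ M.incCost S r + ((d S r : ℝ) : EReal) := by
  by_cases hS : M.Δc S r = ⊤
  · simp [M.incCost_of_eq_top hS]
  · have := h.seller S r
    rw [M.incCost_of_ne_top hS] at this ⊢
    rw [← EReal.coe_neg, EReal.coe_le_coe_iff] at this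
    rw [← EReal.coe_add, EReal.coe_le_coe_iff]
    linarith

/-- If `S` is allocated in order up to a step not before `r`, every successor of `S` receives a
positive quantity on some step not before `r`. -/
theorem exists_pos_step_of_connected {x : Package n → M.Agent → Fin L → ℝ}
    {y : Package n → M.Step → ℝ} (hP : M.PrimalFeasible x y) {S T : Package n}
    (hST : M.G.Connected S T) (hS : M.AllocatedInOrder y S) {r : M.Step}
    (hr : (r : ℕ) ≤ M.lastStep y S) : ∃ r' : M.Step, r ≤ r' ∧ 0 < y T r' := by
  classical
  -- Steps start at 1, which rules out the default value 0 of `lastStep`.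
  have hr0 : ⊥ < (r : ℕ) := (mem_Icc.1 r.2).1
  obtain ⟨t, ht, hrt⟩ := (Finset.le_sup_iff hr0).1 hr
  have hyt : 0 < y S t := (mem_filter.1 ht).2
  have hYle : ∑ s, y S s ≤ ∑ s, y T s := M.G.le_of_charFun_nonneg
    (Y := fun T => ∑ s : M.Step, y T s) (fun U => by
      have := hP.supply U
      have := sum_nonneg fun q (_ : q ∈ univ) => sum_nonneg fun l (_ : l ∈ univ) =>
        hP.x_nonneg U q l
      linarith) hST
  -- Otherwise `T` receives at most the number of steps before `r`, while `S` fills all of these and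
  -- gets more at `t ≥ r`, contradicting `hYle`.
  by_contra! hno
  have hT : ∑ s, y T s ≤ #(univ.filter fun s => s < r) := by
    have h0 : ∑ s, y T s = ∑ s ∈ univ.filter (fun s => s < r), y T s :=
      (sum_filter_of_ne fun s _ hs => not_le.1 fun hle =>
        hs (le_antisymm (hno s hle) (hP.y_nonneg T s))).symm
    rw [h0]
    simpa using sum_le_sum fun s (_ : s ∈ univ.filter fun s => s < r) => hP.y_le_one T s
  have hSlt : (#(univ.filter fun s => s < r) : ℝ) < ∑ s, y S s := by
    have h0 : (#(univ.filter fun s => s < r) : ℝ) = ∑ s ∈ univ.filter (fun s => s < r), y S s := by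
      rw [sum_congr rfl fun s hs => hS s t ((mem_filter.1 hs).2.trans_le hrt) hyt]
      simp
    rw [h0]
    exact sum_lt_sum_of_subset (filter_subset _ _) (mem_univ t)
      (by simpa using hrt) hyt fun s _ _ => hP.y_nonneg S s
  linarith

end Market

/-! ### Package prices and the proposition -/

theorem priceOf_singlePackage {n : ℕ} (L : ℕ) (p : Package n → ℝ) (a : Fin (L + 1))
    (S : Package n) : priceOf L p a (singlePackage S) = p S := by
  classical
  simp [priceOf, singlePackage, Pi.single_apply]

theorem priceOf_add {n : ℕ} (L : ℕ) (p : Package n → ℝ) (a : Fin (L + 1))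
    (k k' : PackageMultiset n) : priceOf L p a (k + k') = priceOf L p a k + priceOf L p a k' := by
  simp [priceOf, add_mul, sum_add_distrib]

theorem mainTheorem5 {n L : ℕ} (M : Market n L)
    (x : Package n → M.Agent → Fin L → ℝ) (y : Package n → M.Step → ℝ)
    (hxy : M.PrimalOptimal x y)
    (b : M.Agent → Fin L → ℝ) (p : Package n → ℝ) (d : Package n → M.Step → ℝ)
    (hbpd : M.DualOptimal b p d) :
    (∀ (r : M.Step) (S : Package n),
      ((p S : ℝ) : EReal) ≤ (∑ S' ∈ M.G.successors S, M.incCost S' r)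
        + ((∑ S' ∈ M.G.successors S, d S' r : ℝ) : EReal)) ∧
    (∀ S : Package n, M.AllocatedInOrder y S →
      ∀ r : M.Step, (r : ℕ) ≤ M.lastStep y S →
        ((p S : ℝ) : EReal) = (∑ S' ∈ M.G.successors S, M.incCost S' r)
          + ((∑ S' ∈ M.G.successors S, d S' r : ℝ) : EReal)) ∧
    IsUniform (priceOf L p) ∧ IsAnonymous (priceOf L p) ∧ IsPackageLinear (priceOf L p) := by
  have hsplit : ∀ (r : M.Step) (S : Package n), (∑ S' ∈ M.G.successors S, M.incCost S' r)
      + ((∑ S' ∈ M.G.successors S, d S' r : ℝ) : EReal)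
      = ∑ S' ∈ M.G.successors S, (M.incCost S' r + ((d S' r : ℝ) : EReal)) := by
    intro r S
    rw [EReal.coe_finset_sum, sum_add_distrib]
  refine ⟨fun r S => ?_, fun S hS r hr => ?_, fun a S k k' => ?_, fun _ _ _ => rfl, fun a k => ?_⟩
  · rw [hsplit, ← M.G.sum_successors_charDual p S, EReal.coe_finset_sum]
    exact sum_le_sum fun S' _ => M.charDual_le_incCost_add hbpd.feasible S' r
  · rw [hsplit, ← M.G.sum_successors_charDual p S, EReal.coe_finset_sum]
    refine sum_congr rfl fun T hT => le_antisymm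
      (M.charDual_le_incCost_add hbpd.feasible T r) ?_
    obtain ⟨r', hrr', hyr'⟩ := M.exists_pos_step_of_connected hxy.feasible
      (by simpa [CostFunctionGraph.successors] using hT) hS hr
    have hmono : M.Δc T r ≤ M.Δc T r' := M.delta_le_of_le (mem_Icc.1 r.2).1 hrr'
    have hfin' : M.Δc T r' ≠ ⊤ := fun h => hyr'.ne' (hxy.eq_zero_of_eq_top T r' h)
    have hfin : M.Δc T r ≠ ⊤ := ne_top_of_le_ne_top hfin' hmono
    have htight : ∀ s : M.Step, 0 < y T s →
        M.realCost T s + d T s = M.G.charDual p T := fun s hs => by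
      have := (mul_eq_zero.1 (hxy.complementary_slackness hbpd T s).2).resolve_right hs.ne'
      linarith
    rw [M.incCost_of_ne_top hfin, ← EReal.coe_add, EReal.coe_le_coe_iff]
    -- `T` itself need not be allocated in order, so step `r` may be empty although the later step
    -- `r'` is used.
    rcases (hxy.feasible.y_nonneg T r).eq_or_lt with h0 | h0
    · have hd : d T r = 0 := by
        simpa [← h0] using (hxy.complementary_slackness hbpd T r).1
      have hcost := M.realCost_le_realCost hmono hfin'
      have := htight r' hyr'
      have := hbpd.feasible.d_nonneg T r'
      linarith
    · exact (htight r h0).le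
  · simp [priceOf_add]
  · simp only [priceOf_singlePackage]
    rfl
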